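/- Consider a tree network with finite bus set $\mathcal V$ and line set $\mathcal E$. Each line $(i,k)\in\mathcal E$ has a nonzero admittance $g_{ik}-jb_{ik}$ with $g_{ik}=g_{ki}\ge 0$, $b_{ik}=b_{ki}\ge 0$. Each bus $i$ has a fixed voltage magnitude $\overline V_i\ge 0$. Each line has limits $\underline\theta_{ik}\le\overline\theta_{ik}$ on the angle difference $\theta_{ik}=-\theta_{ki}$ (so $\underline\theta_{ik}=-\overline\theta_{ki}$), and each bus has active power limits $\underline P_i,\overline P_i\in[-\infty,\infty]$. Assume that $$-\arctan(b_{ik}/g_{ik})<\underline\theta_{ik}\le\overline\theta_{ik}<\arctan(b_{ik}/g_{ik})\qquad\text{for all }(i,k)\in\mathcal E,$$ where $\arctan(b_{ik}/g_{ik})=\pi/2$ if $g_{ik}=0$. For a line $(i,k)$ let $\mathcal F_{ik}\subset\mathbb R^2$ be the set of all pairs $(P_{ik},P_{ki})$ with $$P_{ik}=\overline V_i^2g_{ik}+\overline V_i\overline V_kb_{ik}\sin\theta_{ik}-\overline V_i\overline V_kg_{ik}\cos\theta_{ik},\qquad P_{ki}=\overline V_k^2g_{ik}-\overline V_i\overline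 V_kb_{ik}\sin\theta_{ik}-\overline V_i\overline V_kg_{ik}\cos\theta_{ik},$$ $\underline\theta_{ik}\le\theta_{ik}\le\overline\theta_{ik}$. Let $\mathcal F=\prod_{(i,k)\in\mathcal E}\mathcal F_{ik}\subset\mathbb R^{2|\mathcal E|}$, and let $\mathbf A$ be the linear map that sends a flow vector $\mathbf f=(P_{ik},P_{ki})_{(i,k)\in\mathcal E}$ to the injection vector $\mathbf p=(P_i)_{i\in\mathcal V}$, $P_i=\sum_{k\sim i}P_{ik}$. The injection region is $$\mathcal P=\mathbf A\mathcal F\cap\{\mathbf p\in\mathbb R^{\mathcal V}:\underline P_i\le P_i\le\overline P_i\text{ for all }i\in\mathcal V\}.$$ For $\mathcal A\subset\mathbb R^{\mathcal V}$, let $\mathcal O(\mathcal A)$ be the set of Pareto-optimal points of $\mathcal A$, that is, of those $\mathbf x\in\mathcal A$ for which no $\mathbf y\in\mathcal A$ satisfies $\mathbf y\le\mathbf x$ componentwise with strict inequality in at least one coordinate, and let $\operatorname{conv}(\mathcal A)$ be the convex hull of $\mathcal A$. Suppose that $\mathcal P$ is non-empty. Then: 1. for every $\mathbf p\in\mathcal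 P$ there exists a unique $\mathbf f\in\mathcal F$ with $\mathbf A\mathbf f=\mathbf p$; 2. $\mathcal P=\mathcal O(\mathcal P)$; 3. $\mathcal O(\mathcal P)=\mathcal O(\operatorname{conv}(\mathcal P))$. -/

import Mathlib

open scoped Matrix

/-- The Pareto front `O(A)` of a set `A` of real vectors: the points `x` of `A` such that no
`y` in `A` satisfies `y ≤ x` componentwise with strict inequality in at least one coordinate. -/
def paretoFront {ι : Type*} (A : Set (ι → ℝ)) : Set (ι → ℝ) :=
  {x | x ∈ A ∧ ¬ ∃ y ∈ A, (∀ i, y i ≤ x i) ∧ ∃ i, y i < x i}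

/-- Data of a power network on the graph `G` (vertices are buses, edges are lines) with fixed bus
voltage magnitudes, an angle interval on every line and an active power interval at every bus. -/
structure PowerNetwork {V : Type*} (G : SimpleGraph V) where
  /-- the line admittance is `g - j b` -/
  g : Sym2 V → ℝ
  b : Sym2 V → ℝ
  g_nonneg : ∀ e ∈ G.edgeSet, 0 ≤ g e
  b_nonneg : ∀ e ∈ G.edgeSet, 0 ≤ b e
  /-- the admittance is the inverse of an impedance, hence is not zero -/
  admittance_ne_zero : ∀ e ∈ G.edgeSet, ¬ (g e = 0 ∧ b e = 0)
  /-- the fixed voltage magnitudes -/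
  vmag : V → ℝ
  vmag_nonneg : ∀ i, 0 ≤ vmag i
  /-- lower and upper limits on the angle difference `θ i - θ k` along the line `(i, k)` -/
  angleLo : V → V → ℝ
  angleHi : V → V → ℝ
  /-- the limits do not depend on the direction in which a line is read:
  `θ k - θ i` is the negative of `θ i - θ k` -/
  angleLo_eq_neg_angleHi : ∀ i k, G.Adj i k → angleLo i k = - angleHi k i
  /-- lower and upper limits on the active power injections; an infinite value means that the
  limit is absent -/
  powerLo : V → EReal
  powerHi : V → EReal

namespace PowerNetwork

variable {V : Type*} {G : SimpleGraph V}

/-- `arctan (b / g)` for the line `(i, k)`, with the usual value `π / 2` for a lossless line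
(`g = 0`, and then `b > 0`). -/
noncomputable def angleBound (N : PowerNetwork G) (i k : V) : ℝ :=
  if N.g s(i, k) = 0 then Real.pi / 2 else Real.arctan (N.b s(i, k) / N.g s(i, k))

/-- The angle limits of every line lie strictly inside `(-arctan (b / g), arctan (b / g))`. -/
def AngleAssumption (N : PowerNetwork G) : Prop :=
  ∀ i k, G.Adj i k →
    - N.angleBound i k < N.angleLo i k ∧ N.angleLo i k ≤ N.angleHi i k ∧
      N.angleHi i k < N.angleBound i k

/-- The flow `P_ik` from bus `i` into the line `(i, k)` when the angle difference
`θ i - θ k` equals `t`. -/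
noncomputable def lineFlow (N : PowerNetwork G) (i k : V) (t : ℝ) : ℝ :=
  N.vmag i ^ 2 * N.g s(i, k) + N.vmag i * N.vmag k * N.b s(i, k) * Real.sin t
    - N.vmag i * N.vmag k * N.g s(i, k) * Real.cos t

/-- The angle-constrained flow region of the line `(i, k)`: the pairs `(P_ik, P_ki)`. -/
def lineFlowRegion (N : PowerNetwork G) (i k : V) : Set (ℝ × ℝ) :=
  {P | ∃ t : ℝ, N.angleLo i k ≤ t ∧ t ≤ N.angleHi i k ∧
    P = (N.lineFlow i k t, N.lineFlow k i (-t))}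

/-- The flow region: the product over all lines of the flow regions of the lines. A flow vector
has one coordinate for each direction of each line. -/
def flowRegion (N : PowerNetwork G) : Set (G.Dart → ℝ) :=
  {f | ∀ d : G.Dart, (f d, f d.symm) ∈ N.lineFlowRegion d.fst d.snd}

end PowerNetwork

/-- The matrix `A` that maps a flow vector to the injection vector `P_i = ∑ k, P_ik`. -/
def flowToInjection {V : Type*} [DecidableEq V] (G : SimpleGraph V) : Matrix V G.Dart ℝ :=
  Matrix.of fun i d => if d.fst = i then 1 else 0

namespace PowerNetwork

variable {V : Type*} {G : SimpleGraph V}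

/-- The angle-constrained injection region, the image of the flow region under `A`. -/
def angleInjectionRegion [Fintype V] [DecidableEq V] [DecidableRel G.Adj] (N : PowerNetwork G) :
    Set (V → ℝ) :=
  (fun f : G.Dart → ℝ => flowToInjection G *ᵥ f) '' N.flowRegion

/-- The hyper-rectangle of the bus active power constraints. -/
def powerBox (N : PowerNetwork G) : Set (V → ℝ) :=
  {p | ∀ i, N.powerLo i ≤ (p i : EReal) ∧ (p i : EReal) ≤ N.powerHi i}

/-- The injection region. -/
def injectionRegion [Fintype V] [DecidableEq V] [DecidableRel G.Adj] (N : PowerNetwork G) :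
    Set (V → ℝ) :=
  N.angleInjectionRegion ∩ N.powerBox

end PowerNetwork

/-! Inside the angle limits `P_ik` strictly increases with `θ_ik` (it is constant if an end voltage
vanishes), so along a line one flow rises only if the opposite one falls. If flows `f`, `f'` satisfy
`A f ≤ A f'` and differ, orient each line where they differ away from the end at which `f` is
smaller. Without cycles, some bus on such lines has no outgoing one; there `f ≥ f'` on every line,
strictly on one, which contradicts `A f ≤ A f'`. Hence `f = f'`
(`dartFlow_eq_of_angleInjection_le`). This gives uniqueness and `P = O(P)`.

For the hull, averaging the sines of the angles instead of the flows does not increase any flow, so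
every hull point lies above an injection that obeys the angle limits. Comparison with a point of `P`
then gives `O(P) ⊆ O(conv P)`. For the converse that injection must be made to respect the lower
power limits without leaving the region below the hull point: `exists_angleInjection_between`. -/

namespace SimpleGraph

/-- On a non-empty set of vertices of a finite acyclic graph, every antisymmetric relation leaves
some vertex unrelated to all its neighbours in the set. -/
theorem IsAcyclic.exists_forall_adj_not_rel {V : Type*} [Finite V] {G : SimpleGraph V}
    (hG : G.IsAcyclic) (R : V → V → Prop) (hR : ∀ i k, R i k → ¬ R k i) {S : Set V}
    (hS : S.Nonempty) : ∃ i ∈ S, ∀ k ∈ S, G.Adj i k → ¬ R i k := by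
  by_contra! hcon
  -- If every vertex of `S` had an `R`-successor in `S`, following successors would give arbitrarily
  -- long paths.
  have key : ∀ n : ℕ, ∃ u v, ∃ p : G.Walk u v,
      p.IsPath ∧ p.length = n ∧ v ∈ S ∧ (p.Nil ∨ R p.penultimate v) := by
    intro n
    induction n with
    | zero =>
      obtain ⟨v, hv⟩ := hS
      exact ⟨v, v, Walk.nil, Walk.IsPath.nil, rfl, hv, Or.inl Walk.Nil.nil⟩
    | succ n ih =>
      obtain ⟨u, v, p, hp, hn, hv, hpen⟩ := ih
      obtain ⟨k, hk, hadj, hrel⟩ := hcon v hv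
      have hmem : k ∉ p.support := by
        intro hmem
        -- Acyclicity lets the path be re-entered only at its penultimate vertex, that is by
        -- reversing the last `R`-step.
        have heq := hG.eq_penultimate_of_adj_end hp hadj hmem
        rcases hpen with hnil | hpen
        · cases hnil
          exact hadj.ne heq.symm
        · rw [← heq] at hpen
          exact hR _ _ hrel hpen
      refine ⟨u, k, p.concat hadj, hp.concat hmem hadj, by simp [hn], hk, Or.inr ?_⟩
      rwa [Walk.penultimate_concat]
  have := Fintype.ofFinite V
  obtain ⟨u, v, p, hp, hn, -⟩ := key (Fintype.card V)
  exact absurd hp.length_lt (by omega)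

end SimpleGraph

/-! ### Monotonicity of the flow on a single line -/

namespace PowerNetwork

variable {V : Type*} {G : SimpleGraph V} (N : PowerNetwork G)

theorem angleBound_comm (i k : V) : N.angleBound k i = N.angleBound i k := by
  simp [angleBound, Sym2.eq_swap]

theorem angleBound_le_pi_div_two (i k : V) : N.angleBound i k ≤ Real.pi / 2 := by
  unfold angleBound
  split_ifs
  · exact le_rfl
  · exact (Real.arctan_lt_pi_div_two _).le

theorem lineFlow_eq_of_vmag_mul_eq_zero {i k : V} (h : N.vmag i * N.vmag k = 0) (x y : ℝ) :
    N.lineFlow i k x = N.lineFlow i k y := by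
  simp [lineFlow, h]

theorem continuous_lineFlow (i k : V) : Continuous (N.lineFlow i k) := by
  unfold lineFlow
  fun_prop

theorem angleHi_eq_neg_angleLo {i k : V} (h : G.Adj i k) :
    N.angleHi i k = - N.angleLo k i := by
  rw [N.angleLo_eq_neg_angleHi k i h.symm, neg_neg]

variable {N}

/-- Up to the voltage factor this is the derivative of `P_ik`; for `g > 0` its positivity means `tan
m > -b / g`. -/
theorem b_mul_cos_add_g_mul_sin_pos {i k : V} (hadj : G.Adj i k) {m : ℝ}
    (hm1 : - N.angleBound i k < m) (hm2 : m < N.angleBound i k) :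
    0 < N.b s(i, k) * Real.cos m + N.g s(i, k) * Real.sin m := by
  have hg := N.g_nonneg _ ((G.mem_edgeSet).2 hadj)
  have hb := N.b_nonneg _ ((G.mem_edgeSet).2 hadj)
  have hne := N.admittance_ne_zero _ ((G.mem_edgeSet).2 hadj)
  have hle := N.angleBound_le_pi_div_two i k
  have hcos : 0 < Real.cos m := Real.cos_pos_of_mem_Ioo ⟨by linarith, by linarith⟩
  rcases hg.eq_or_lt with h0 | hgpos
  · have hbpos : 0 < N.b s(i, k) := lt_of_le_of_ne hb fun h => hne ⟨h0.symm, h.symm⟩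
    rw [← h0, zero_mul, add_zero]
    exact mul_pos hbpos hcos
  · have htan : - (N.b s(i, k) / N.g s(i, k)) < Real.tan m := by
      have h : Real.arctan (- (N.b s(i, k) / N.g s(i, k))) < m := by
        rw [Real.arctan_neg]
        simpa [angleBound, hgpos.ne'] using hm1
      have h2 := Real.tan_lt_tan_of_lt_of_lt_pi_div_two (Real.neg_pi_div_two_lt_arctan _)
        (by linarith) h
      rwa [Real.tan_arctan] at h2
    rw [Real.tan_eq_sin_div_cos, ← neg_div, div_lt_div_iff₀ hgpos hcos] at htan
    linarith

theorem lineFlow_strictMonoOn (hangle : N.AngleAssumption) {i k : V} (hadj : G.Adj i k)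
    (hv : N.vmag i * N.vmag k ≠ 0) :
    StrictMonoOn (N.lineFlow i k) (Set.Icc (N.angleLo i k) (N.angleHi i k)) := by
  intro x hx y hy hxy
  obtain ⟨h1, -, h2⟩ := hangle i k hadj
  have hle := N.angleBound_le_pi_div_two i k
  -- Sum-to-product formulas turn the increment of the flow into this factor at the midpoint times
  -- the sine of the half-difference.
  have hpos := b_mul_cos_add_g_mul_sin_pos (N := N) hadj (m := (y + x) / 2)
    (by linarith [hx.1, hy.1]) (by linarith [hx.2, hy.2])
  have hsin : 0 < Real.sin ((y - x) / 2) :=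
    Real.sin_pos_of_pos_of_lt_pi (by linarith) (by linarith [hx.1, hy.2, Real.pi_pos])
  have hvpos : 0 < N.vmag i * N.vmag k :=
    lt_of_le_of_ne (mul_nonneg (N.vmag_nonneg i) (N.vmag_nonneg k)) hv.symm
  have hdiff : N.lineFlow i k y - N.lineFlow i k x = N.vmag i * N.vmag k *
      (N.b s(i, k) * (Real.sin y - Real.sin x) - N.g s(i, k) * (Real.cos y - Real.cos x)) := by
    unfold lineFlow
    ring
  have hfac : N.b s(i, k) * (Real.sin y - Real.sin x) - N.g s(i, k) * (Real.cos y - Real.cos x)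
      = 2 * Real.sin ((y - x) / 2) * (N.b s(i, k) * Real.cos ((y + x) / 2)
        + N.g s(i, k) * Real.sin ((y + x) / 2)) := by
    rw [Real.sin_sub_sin, Real.cos_sub_cos]
    ring
  rw [← sub_pos, hdiff, hfac]
  positivity

/-! ### Antisymmetric angles as coordinates on the flow region -/

variable (N) in
/-- The antisymmetric angle differences on the darts that obey the angle limits. -/
def angleRegion : Set (G.Dart → ℝ) :=
  {t | ∀ d : G.Dart, t d.symm = - t d ∧ t d ∈ Set.Icc (N.angleLo d.fst d.snd)
    (N.angleHi d.fst d.snd)}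

variable (N) in
/-- The flow vector of given angle differences. -/
noncomputable def dartFlow (t : G.Dart → ℝ) (d : G.Dart) : ℝ :=
  N.lineFlow d.fst d.snd (t d)

/-- The two darts of a line carry opposite angles, and each flow increases with its own angle. This
makes the comparison of two flow vectors an antisymmetric relation on buses. -/
theorem dartFlow_symm_lt (hangle : N.AngleAssumption) {s t : G.Dart → ℝ}
    (hs : s ∈ N.angleRegion) (ht : t ∈ N.angleRegion) {d : G.Dart}
    (h : N.dartFlow s d < N.dartFlow t d) :
    N.vmag d.fst * N.vmag d.snd ≠ 0 ∧ s d < t d ∧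
      N.dartFlow t d.symm < N.dartFlow s d.symm := by
  have hv : N.vmag d.fst * N.vmag d.snd ≠ 0 := fun h0 =>
    h.ne (N.lineFlow_eq_of_vmag_mul_eq_zero h0 _ _)
  have hlt : s d < t d :=
    ((lineFlow_strictMonoOn hangle d.adj hv).lt_iff_lt (hs d).2 (ht d).2).1 h
  refine ⟨hv, hlt, lineFlow_strictMonoOn hangle d.adj.symm (by rwa [mul_comm])
    (ht d.symm).2 (hs d.symm).2 ?_⟩
  rw [(ht d).1, (hs d).1]
  exact neg_lt_neg hlt

theorem dartFlow_mem_flowRegion {t : G.Dart → ℝ} (ht : t ∈ N.angleRegion) :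
    N.dartFlow t ∈ N.flowRegion := by
  intro d
  refine ⟨t d, (ht d).2.1, (ht d).2.2, ?_⟩
  rw [← (ht d).1]
  rfl

theorem exists_dartFlow_eq (hangle : N.AngleAssumption) {f : G.Dart → ℝ}
    (hf : f ∈ N.flowRegion) : ∃ t ∈ N.angleRegion, N.dartFlow t = f := by
  choose t hlo hhi heq using hf
  have hneg : ∀ d : G.Dart, - t d.symm ∈
      Set.Icc (N.angleLo d.fst d.snd) (N.angleHi d.fst d.snd) := by
    intro d
    rw [N.angleHi_eq_neg_angleLo d.adj, N.angleLo_eq_neg_angleHi _ _ d.adj]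
    exact ⟨neg_le_neg (hhi d.symm), neg_le_neg (hlo d.symm)⟩
  -- The angles chosen for the two darts of a line need not be opposite. Both `t d` and `-t d.symm`
  -- produce `f d`, so they agree unless the flow ignores the angle; their average works in either
  -- case.
  refine ⟨fun d => (t d - t d.symm) / 2, fun d => ⟨?_, ?_, ?_⟩, ?_⟩
  · simp only [SimpleGraph.Dart.symm_symm]
    ring
  · dsimp only
    linarith [hlo d, (hneg d).1]
  · dsimp only
    linarith [hhi d, (hneg d).2]
  · funext d
    have hfd : f d = N.lineFlow d.fst d.snd (t d) := congrArg Prod.fst (heq d)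
    have hfd' : f d = N.lineFlow d.fst d.snd (- t d.symm) := by
      have := congrArg Prod.snd (heq d.symm)
      simpa using this
    rw [hfd]
    by_cases hv : N.vmag d.fst * N.vmag d.snd = 0
    · exact N.lineFlow_eq_of_vmag_mul_eq_zero hv _ _
    · have := (lineFlow_strictMonoOn hangle d.adj hv).injOn ⟨hlo d, hhi d⟩ (hneg d)
        (hfd.symm.trans hfd')
      unfold dartFlow
      congr 1
      linarith

theorem isCompact_angleRegion : IsCompact N.angleRegion := by
  have hK : IsCompact (Set.univ.pi fun d : G.Dart =>
      Set.Icc (N.angleLo d.fst d.snd) (N.angleHi d.fst d.snd)) :=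
    isCompact_univ_pi fun _ => isCompact_Icc
  have hC : IsClosed {t : G.Dart → ℝ | ∀ d, t d.symm = - t d} := by
    simp only [Set.ofPred_forall]
    exact isClosed_iInter fun d => isClosed_eq (by fun_prop) (by fun_prop)
  convert hK.inter_right hC using 1
  ext t
  simp only [angleRegion, Set.mem_ofPred_eq, Set.mem_inter_iff, Set.mem_univ_pi]
  exact ⟨fun h => ⟨fun d => (h d).2, fun d => (h d).1⟩, fun h d => ⟨h.2 d, h.1 d⟩⟩

theorem convex_powerBox : Convex ℝ N.powerBox := by
  have h : N.powerBox = Set.univ.pi fun i =>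
      ((↑) : ℝ → EReal) ⁻¹' Set.Icc (N.powerLo i) (N.powerHi i) := by
    ext p
    simp [powerBox, Set.mem_pi]
  rw [h]
  refine convex_pi fun i _ => Set.OrdConnected.convex ?_
  exact Set.ordConnected_Icc.preimage_mono EReal.coe_strictMono.monotone

/-- The sine of the new angle difference is the convex combination of the given sines; its cosine
is then at least the convex combination of the given cosines. -/
theorem exists_dartFlow_le_convexCombination (hangle : N.AngleAssumption) {s t : G.Dart → ℝ}
    (hs : s ∈ N.angleRegion) (ht : t ∈ N.angleRegion) {α β : ℝ} (hα : 0 ≤ α) (hβ : 0 ≤ β)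
    (hαβ : α + β = 1) :
    ∃ u ∈ N.angleRegion, ∀ d, N.dartFlow u d ≤ α * N.dartFlow s d + β * N.dartFlow t d := by
  have hsin : ∀ d : G.Dart, Real.sin (N.angleLo d.fst d.snd) ≤
        α * Real.sin (s d) + β * Real.sin (t d) ∧
      α * Real.sin (s d) + β * Real.sin (t d) ≤ Real.sin (N.angleHi d.fst d.snd) := by
    intro d
    obtain ⟨h1, -, h2⟩ := hangle _ _ d.adj
    have hle := N.angleBound_le_pi_div_two d.fst d.snd
    have hlo : ∀ x ∈ Set.Icc (N.angleLo d.fst d.snd) (N.angleHi d.fst d.snd),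
        Real.sin (N.angleLo d.fst d.snd) ≤ Real.sin x := fun x hx =>
      Real.sin_le_sin_of_le_of_le_pi_div_two (by linarith) (by linarith [hx.2]) hx.1
    have hhi : ∀ x ∈ Set.Icc (N.angleLo d.fst d.snd) (N.angleHi d.fst d.snd),
        Real.sin x ≤ Real.sin (N.angleHi d.fst d.snd) := fun x hx =>
      Real.sin_le_sin_of_le_of_le_pi_div_two (by linarith [hx.1]) (by linarith) hx.2
    have := convex_Icc (Real.sin (N.angleLo d.fst d.snd)) (Real.sin (N.angleHi d.fst d.snd))
      ⟨hlo _ (hs d).2, hhi _ (hs d).2⟩ ⟨hlo _ (ht d).2, hhi _ (ht d).2⟩ hα hβ hαβ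
    exact this
  refine ⟨fun d => Real.arcsin (α * Real.sin (s d) + β * Real.sin (t d)), fun d => ⟨?_, ?_, ?_⟩,
    fun d => ?_⟩
  · simp only [(hs d).1, (ht d).1, Real.sin_neg]
    rw [← Real.arcsin_neg]
    congr 1
    ring
  · obtain ⟨h1, h, h2⟩ := hangle _ _ d.adj
    have hle := N.angleBound_le_pi_div_two d.fst d.snd
    rw [← Real.arcsin_sin (x := N.angleLo d.fst d.snd) (by linarith) (by linarith)]
    exact Real.monotone_arcsin (hsin d).1
  · obtain ⟨h1, h, h2⟩ := hangle _ _ d.adj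
    have hle := N.angleBound_le_pi_div_two d.fst d.snd
    rw [← Real.arcsin_sin (x := N.angleHi d.fst d.snd) (by linarith) (by linarith)]
    exact Real.monotone_arcsin (hsin d).2
  · have hcos : α * Real.cos (s d) + β * Real.cos (t d) ≤
        Real.cos (Real.arcsin (α * Real.sin (s d) + β * Real.sin (t d))) := by
      rw [Real.cos_arcsin]
      apply Real.le_sqrt_of_sq_le
      have h1 := Real.sin_sq_add_cos_sq (s d)
      have h2 := Real.sin_sq_add_cos_sq (t d)
      have h3 := Real.cos_le_one (s d - t d)
      rw [Real.cos_sub] at h3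
      have h4 := mul_le_mul_of_nonneg_left h3 (mul_nonneg hα hβ)
      have hβ' : β = 1 - α := by linarith
      subst hβ'
      -- After expansion the claim is `2αβ cos (s d - t d) ≤ 2αβ`.
      linear_combination α ^ 2 * h1 + (1 - α) ^ 2 * h2 + 2 * h4
    have hcoef : 0 ≤ N.vmag d.fst * N.vmag d.snd * N.g s(d.fst, d.snd) :=
      mul_nonneg (mul_nonneg (N.vmag_nonneg _) (N.vmag_nonneg _))
        (N.g_nonneg _ ((G.mem_edgeSet).2 d.adj))
    unfold dartFlow lineFlow
    rw [Real.sin_arcsin ((Real.neg_one_le_sin _).trans (hsin d).1)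
      ((hsin d).2.trans (Real.sin_le_one _))]
    have h := mul_le_mul_of_nonneg_left hcos hcoef
    have hβ' : β = 1 - α := by linarith
    subst hβ'
    linarith

/-! ### Injections on an acyclic network -/

section Injection

variable [Fintype V] [DecidableEq V] [DecidableRel G.Adj]

variable (N) in
/-- The injection vector of given angle differences. -/
noncomputable def angleInjection (t : G.Dart → ℝ) (i : V) : ℝ :=
  ∑ d : G.Dart with d.fst = i, N.dartFlow t d

theorem flowToInjection_mulVec_dartFlow (t : G.Dart → ℝ) :
    flowToInjection G *ᵥ N.dartFlow t = N.angleInjection t := by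
  funext i
  simp [Matrix.mulVec, dotProduct, flowToInjection, angleInjection, Finset.sum_filter]

theorem angleInjectionRegion_eq_image (hangle : N.AngleAssumption) :
    N.angleInjectionRegion = N.angleInjection '' N.angleRegion := by
  ext p
  constructor
  · rintro ⟨f, hf, rfl⟩
    obtain ⟨t, ht, rfl⟩ := exists_dartFlow_eq hangle hf
    exact ⟨t, ht, (flowToInjection_mulVec_dartFlow t).symm⟩
  · rintro ⟨t, ht, rfl⟩
    exact ⟨_, dartFlow_mem_flowRegion ht, flowToInjection_mulVec_dartFlow t⟩

theorem dartFlow_eq_of_angleInjection_le (hangle : N.AngleAssumption) (hG : G.IsAcyclic)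
    {s t : G.Dart → ℝ} (hs : s ∈ N.angleRegion) (ht : t ∈ N.angleRegion)
    (hle : N.angleInjection s ≤ N.angleInjection t) : N.dartFlow s = N.dartFlow t := by
  by_contra hne
  obtain ⟨d₀, hd₀⟩ := Function.ne_iff.1 hne
  -- At the selected bus no outgoing flow of `s` is below that of `t`, and one is strictly above, so
  -- the injection of `s` is larger there.
  obtain ⟨i, ⟨d, rfl, hd⟩, hi⟩ := hG.exists_forall_adj_not_rel
    (fun i k => ∃ h : G.Adj i k, N.dartFlow s ⟨(i, k), h⟩ < N.dartFlow t ⟨(i, k), h⟩)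
    (fun i k ⟨h, hlt⟩ ⟨_, hlt'⟩ => (dartFlow_symm_lt hangle hs ht hlt).2.2.not_gt hlt')
    (S := {i | ∃ d : G.Dart, d.fst = i ∧ N.dartFlow s d ≠ N.dartFlow t d})
    ⟨d₀.fst, d₀, rfl, hd₀⟩
  have hge : ∀ e : G.Dart, e.fst = d.fst → N.dartFlow t e ≤ N.dartFlow s e := by
    rintro ⟨⟨j, k⟩, h⟩ hj
    obtain rfl : j = d.fst := hj
    by_contra! hlt
    exact hi k ⟨⟨(k, d.fst), h.symm⟩, rfl, (dartFlow_symm_lt hangle hs ht hlt).2.2.ne'⟩ h ⟨h, hlt⟩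
  refine (hle d.fst).not_gt (Finset.sum_lt_sum (fun e he => hge e (Finset.mem_filter.1 he).2)
    ⟨d, by simp, lt_of_le_of_ne (hge d rfl) hd.symm⟩)

theorem continuous_angleInjection : Continuous N.angleInjection := by
  refine continuous_pi fun i => continuous_finsetSum _ fun d _ => ?_
  exact (N.continuous_lineFlow d.fst d.snd).comp (continuous_apply d)

/-- Moving the angle difference of one line towards that of another point of the region lowers
the injection at the far end, keeps a strict bound at the near end, and changes nothing else. -/
theorem exists_shift (hangle : N.AngleAssumption) {s t : G.Dart → ℝ}
    (hs : s ∈ N.angleRegion) (ht : t ∈ N.angleRegion) {d : G.Dart}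
    (hd : N.dartFlow s d < N.dartFlow t d) {c : ℝ} (hc : N.angleInjection s d.fst < c) :
    ∃ u ∈ N.angleRegion, N.angleInjection u d.fst < c ∧
      N.angleInjection u d.snd < N.angleInjection s d.snd ∧
      ∀ j, j ≠ d.fst → j ≠ d.snd → N.angleInjection u j = N.angleInjection s j := by
  obtain ⟨hv, hlt, -⟩ := dartFlow_symm_lt hangle hs ht hd
  -- Both darts of the line move together to keep antisymmetry. Continuity at `ε = 0` preserves the
  -- strict bound `c`; monotonicity lowers the far end.
  let u : ℝ → G.Dart → ℝ := fun ε e =>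
    if e = d ∨ e = d.symm then s e + ε * (t e - s e) else s e
  have hcont : Continuous u := by
    refine continuous_pi fun e => ?_
    by_cases h : e = d ∨ e = d.symm
    · simp only [u, if_pos h]
      fun_prop
    · simp only [u, if_neg h]
      fun_prop
  have hu0 : u 0 = s := by
    funext e
    simp [u]
  have hev : ∀ᶠ ε in nhds (0 : ℝ), N.angleInjection (u ε) d.fst < c := by
    have hcont' : Continuous fun ε => N.angleInjection (u ε) d.fst :=
      (continuous_apply d.fst).comp (continuous_angleInjection.comp hcont)
    exact hcont'.continuousAt.eventually_lt_const (by simpa [hu0] using hc)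
  obtain ⟨ε, hε, hε0, hε1⟩ : ∃ ε, N.angleInjection (u ε) d.fst < c ∧ 0 < ε ∧ ε < 1 := by
    have h1 : ∀ᶠ ε in nhdsWithin (0 : ℝ) (Set.Ioi 0), ε ∈ Set.Ioo (0 : ℝ) 1 :=
      Ioo_mem_nhdsGT one_pos
    obtain ⟨ε, h⟩ := ((hev.filter_mono nhdsWithin_le_nhds).and h1).exists
    exact ⟨ε, h.1, h.2.1, h.2.2⟩
  have hmem : u ε ∈ N.angleRegion := by
    intro e
    have hsymm : (e.symm = d ∨ e.symm = d.symm) ↔ (e = d ∨ e = d.symm) := by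
      rw [or_comm, SimpleGraph.Dart.symm_involutive.injective.eq_iff,
        SimpleGraph.Dart.symm_involutive.eq_iff]
    by_cases h : e = d ∨ e = d.symm
    · simp only [u, if_pos h, if_pos (hsymm.2 h)]
      refine ⟨by rw [(hs e).1, (ht e).1]; ring, ?_⟩
      have := (convex_Icc (N.angleLo e.fst e.snd) (N.angleHi e.fst e.snd)) (hs e).2 (ht e).2
        (sub_nonneg.2 hε1.le) hε0.le (by ring)
      convert this using 1
      simp only [smul_eq_mul]
      ring
    · simp only [u, if_neg h, if_neg (fun h' => h (hsymm.1 h'))]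
      exact hs e
  refine ⟨u ε, hmem, hε, ?_, ?_⟩
  · have hstrict : N.dartFlow (u ε) d.symm < N.dartFlow s d.symm := by
      refine lineFlow_strictMonoOn hangle d.adj.symm (by rwa [mul_comm])
        (hmem d.symm).2 (hs d.symm).2 ?_
      rw [(hmem d).1, (hs d).1, neg_lt_neg_iff]
      simp only [u, true_or, if_true]
      nlinarith
    refine Finset.sum_lt_sum (fun e he => ?_) ⟨d.symm, by simp, hstrict⟩
    by_cases hed : e = d.symm
    · rw [hed]
      exact hstrict.le
    · have hed' : e ≠ d := by
        rintro rfl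
        exact e.adj.ne (Finset.mem_filter.1 he).2
      simp [dartFlow, u, hed, hed']
  · intro j hj1 hj2
    refine Finset.sum_congr rfl fun e he => ?_
    obtain rfl := (Finset.mem_filter.1 he).2
    have hed' : e ≠ d := by
      rintro rfl
      exact hj1 rfl
    have hed : e ≠ d.symm := by
      rintro rfl
      exact hj2 rfl
    simp [dartFlow, u, hed, hed']

/-- If the lower limits `L` are attainable, then below each `p ≥ L` that dominates an attainable
injection there is an attainable injection that respects `L`. -/
theorem exists_angleInjection_between (hangle : N.AngleAssumption) (hG : G.IsAcyclic)
    {s₀ s : G.Dart → ℝ} {L p : V → ℝ} (hs₀ : s₀ ∈ N.angleRegion)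
    (hL₀ : L ≤ N.angleInjection s₀) (hLp : L ≤ p) (hs : s ∈ N.angleRegion)
    (hsp : N.angleInjection s ≤ p) :
    ∃ t ∈ N.angleRegion, L ≤ N.angleInjection t ∧ N.angleInjection t ≤ p := by
  classical
  have hK : IsCompact (N.angleRegion ∩ {t | N.angleInjection t ≤ p}) :=
    isCompact_angleRegion.inter_right (isClosed_le continuous_angleInjection continuous_const)
  have hcont : Continuous fun t => ∑ i, max (N.angleInjection t i) (L i) :=
    continuous_finsetSum _ fun i _ =>
      ((continuous_apply i).comp continuous_angleInjection).max continuous_const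
  -- Minimality makes `r` rigid: an injection below `r` can be strictly below it only at buses where
  -- `r = L`.
  obtain ⟨t₁, ⟨ht₁, ht₁p⟩, hmin⟩ := hK.exists_isMinOn ⟨s, hs, hsp⟩ hcont.continuousOn
  let r : V → ℝ := fun i => max (N.angleInjection t₁ i) (L i)
  have hrp : r ≤ p := fun i => max_le (ht₁p i) (hLp i)
  have htight : ∀ t ∈ N.angleRegion, N.angleInjection t ≤ r →
      ∀ i, max (N.angleInjection t i) (L i) = r i := by
    intro t ht htr i
    have hle : ∀ i ∈ Finset.univ, max (N.angleInjection t i) (L i) ≤ r i := fun i _ =>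
      max_le (htr i) (le_max_right _ _)
    have hsum : ∑ i, r i ≤ ∑ i, max (N.angleInjection t i) (L i) :=
      hmin ⟨ht, htr.trans hrp⟩
    exact (Finset.sum_eq_sum_iff_of_le hle).1 (le_antisymm (Finset.sum_le_sum hle) hsum) i
      (Finset.mem_univ i)
  -- Among the injections below `r`, take one with a maximal set of slack buses. If that set is
  -- empty, the injection equals `r` and lies between `L` and `p`.
  obtain ⟨-, ⟨t, ⟨ht, htr⟩, rfl⟩, hmax⟩ := (Set.toFinite
    ((fun t : G.Dart → ℝ => {i | N.angleInjection t i < r i}) ''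
      {t | t ∈ N.angleRegion ∧ N.angleInjection t ≤ r})).exists_maximal
    ⟨_, t₁, ⟨ht₁, fun i => le_max_left _ _⟩, rfl⟩
  rcases Set.eq_empty_or_nonempty {i | N.angleInjection t i < r i} with hS | hS
  · have heq : N.angleInjection t = r := by
      refine le_antisymm htr fun i => ?_
      by_contra! hlt
      exact Set.eq_empty_iff_forall_notMem.1 hS i hlt
    exact ⟨t, ht, heq ▸ fun i => le_max_right _ _, heq ▸ hrp⟩
  exfalso
  obtain ⟨i, hiS, hi⟩ := hG.exists_forall_adj_not_rel
    (fun i k => ∃ h : G.Adj i k, N.dartFlow t ⟨(i, k), h⟩ < N.dartFlow s₀ ⟨(i, k), h⟩)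
    (fun i k ⟨h, hlt⟩ ⟨_, hlt'⟩ => (dartFlow_symm_lt hangle ht hs₀ hlt).2.2.not_gt hlt') hS
  have hiS' : N.angleInjection t i < r i := hiS
  have hLr : r i = L i := by
    rcases max_choice (N.angleInjection t i) (L i) with h | h
    · exact absurd (h.symm.trans (htight t ht htr i)) hiS'.ne
    · exact (htight t ht htr i).symm.trans h
  -- A line violating this leads out of the slack set, by the choice of `i`. A small shift along it
  -- towards `s₀` would make its far end slack too, against maximality. Summing the inequality at
  -- `i` then gives `L i ≤ N.angleInjection t i`, which slackness at `i` excludes.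
  have hge : ∀ d : G.Dart, d.fst = i → N.dartFlow s₀ d ≤ N.dartFlow t d := by
    rintro d rfl
    by_contra! hlt
    have hk : d.snd ∉ {i | N.angleInjection t i < r i} := fun hk => hi _ hk d.adj ⟨d.adj, hlt⟩
    obtain ⟨u, hu, hu1, hu2, hu3⟩ := exists_shift hangle ht hs₀ hlt hiS'
    have hu2' := hu2.trans_le (htr d.snd)
    have hur : N.angleInjection u ≤ r := by
      intro j
      by_cases h1 : j = d.fst
      · exact h1 ▸ hu1.le
      by_cases h2 : j = d.snd
      · exact h2 ▸ hu2'.le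
      exact hu3 j h1 h2 ▸ htr j
    refine hk (hmax ⟨u, ⟨hu, hur⟩, rfl⟩ (fun j hj => ?_) hu2')
    by_cases h1 : j = d.fst
    · exact h1 ▸ hu1
    by_cases h2 : j = d.snd
    · exact h2 ▸ hu2'
    exact (hu3 j h1 h2).trans_lt hj
  have hcontra : N.angleInjection s₀ i ≤ N.angleInjection t i :=
    Finset.sum_le_sum fun d hd => hge d (Finset.mem_filter.1 hd).2
  exact absurd ((hL₀ i).trans hcontra) (not_le.2 (hLr ▸ hiS'))

/-! ### Comparison with the convex hull -/

theorem convex_upperClosure_angleInjection (hangle : N.AngleAssumption) :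
    Convex ℝ {p : V → ℝ | ∃ t ∈ N.angleRegion, N.angleInjection t ≤ p} := by
  rintro p ⟨s, hs, hsp⟩ q ⟨t, ht, htq⟩ α β hα hβ hαβ
  obtain ⟨u, hu, hle⟩ := exists_dartFlow_le_convexCombination hangle hs ht hα hβ hαβ
  refine ⟨u, hu, fun i => ?_⟩
  calc N.angleInjection u i ≤ ∑ d : G.Dart with d.fst = i,
        (α * N.dartFlow s d + β * N.dartFlow t d) := Finset.sum_le_sum fun d _ => hle d
    _ = α * N.angleInjection s i + β * N.angleInjection t i := by
        rw [Finset.sum_add_distrib, ← Finset.mul_sum, ← Finset.mul_sum]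
        rfl
    _ ≤ α * p i + β * q i := by
        gcongr
        exacts [hsp i, htq i]

theorem exists_angleInjection_le_of_mem_convexHull (hangle : N.AngleAssumption) {p : V → ℝ}
    (hp : p ∈ convexHull ℝ N.injectionRegion) :
    ∃ t ∈ N.angleRegion, N.angleInjection t ≤ p := by
  refine convexHull_min ?_ (convex_upperClosure_angleInjection hangle) hp
  rintro q ⟨hq, -⟩
  rw [angleInjectionRegion_eq_image hangle] at hq
  obtain ⟨t, ht, rfl⟩ := hq
  exact ⟨t, ht, le_rfl⟩

/-- An injection `s` obeying the angle limits lies below `q`; rigidity applied to `s ≤ q ≤ p` forces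
equality throughout. -/
theorem eq_of_mem_convexHull_of_le (hangle : N.AngleAssumption) (hG : G.IsAcyclic) {p q : V → ℝ}
    (hp : p ∈ N.injectionRegion) (hq : q ∈ convexHull ℝ N.injectionRegion) (hqp : q ≤ p) :
    q = p := by
  obtain ⟨s, hs, hsq⟩ := exists_angleInjection_le_of_mem_convexHull hangle hq
  have hp' := hp.1
  rw [angleInjectionRegion_eq_image hangle] at hp'
  obtain ⟨t, ht, rfl⟩ := hp'
  have h := dartFlow_eq_of_angleInjection_le hangle hG hs ht (hsq.trans hqp)
  refine le_antisymm hqp (le_trans (le_of_eq ?_) hsq)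
  rw [← flowToInjection_mulVec_dartFlow, ← flowToInjection_mulVec_dartFlow, h]

/-- Upper power limits are inherited from `p`, which lies in the convex box, so only the lower
limits need repair. -/
theorem exists_mem_injectionRegion_le (hangle : N.AngleAssumption) (hG : G.IsAcyclic) {p : V → ℝ}
    (hp : p ∈ convexHull ℝ N.injectionRegion) : ∃ q ∈ N.injectionRegion, q ≤ p := by
  obtain ⟨p₀, hp₀⟩ : N.injectionRegion.Nonempty := convexHull_nonempty_iff.1 ⟨p, hp⟩
  obtain ⟨s, hs, hsp⟩ := exists_angleInjection_le_of_mem_convexHull hangle hp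
  have hpbox : p ∈ N.powerBox :=
    convexHull_min Set.inter_subset_right convex_powerBox hp
  obtain ⟨hp₀', hbox₀⟩ := hp₀
  rw [angleInjectionRegion_eq_image hangle] at hp₀'
  obtain ⟨s₀, hs₀, rfl⟩ := hp₀'
  -- A real lower limit is needed; where the given one is `⊥`, any value below both injections
  -- serves.
  have hL : ∀ i, ∃ l : ℝ, l ≤ N.angleInjection s₀ i ∧ l ≤ p i ∧
      ∀ x : ℝ, l ≤ x → N.powerLo i ≤ (x : EReal) := by
    intro i
    rcases eq_or_ne (N.powerLo i) ⊥ with hbot | hbot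
    · exact ⟨min (N.angleInjection s₀ i) (p i), min_le_left _ _, min_le_right _ _,
        fun x _ => hbot ▸ bot_le⟩
    · have htop : N.powerLo i ≠ ⊤ := ne_top_of_le_ne_top (EReal.coe_ne_top _) (hbox₀ i).1
      have hcoe := EReal.coe_toReal htop hbot
      refine ⟨(N.powerLo i).toReal, ?_, ?_, fun x hx => ?_⟩
      · rw [← EReal.coe_le_coe_iff, hcoe]
        exact (hbox₀ i).1
      · rw [← EReal.coe_le_coe_iff, hcoe]
        exact (hpbox i).1
      · rw [← hcoe]
        exact EReal.coe_le_coe_iff.2 hx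
  choose L hL₀ hLp hLx using hL
  obtain ⟨t, ht, hLt, htp⟩ := exists_angleInjection_between hangle hG hs₀ hL₀ hLp hs hsp
  refine ⟨N.angleInjection t, ⟨?_, fun i => ⟨hLx i _ (hLt i), ?_⟩⟩, htp⟩
  · rw [angleInjectionRegion_eq_image hangle]
    exact ⟨t, ht, rfl⟩
  · exact (EReal.coe_le_coe_iff.2 (htp i)).trans (hpbox i).2

end Injection

end PowerNetwork

theorem mainTheorem1 {V : Type*} [Fintype V] [DecidableEq V]
    (G : SimpleGraph V) [DecidableRel G.Adj] (hG : G.IsTree)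
    (N : PowerNetwork G) (hangle : N.AngleAssumption)
    (hne : N.injectionRegion.Nonempty) :
    (∀ p ∈ N.injectionRegion, ∃! f : G.Dart → ℝ,
        f ∈ N.flowRegion ∧ flowToInjection G *ᵥ f = p) ∧
      N.injectionRegion = paretoFront N.injectionRegion ∧
      paretoFront N.injectionRegion = paretoFront (convexHull ℝ N.injectionRegion) := by
  have hsub := subset_convexHull ℝ N.injectionRegion
  have hP : N.injectionRegion = paretoFront N.injectionRegion := by
    refine Set.Subset.antisymm (fun p hp => ⟨hp, ?_⟩) fun p hp => hp.1
    rintro ⟨q, hq, hqp, i, hi⟩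
    have := PowerNetwork.eq_of_mem_convexHull_of_le hangle hG.2 hp (hsub hq) hqp
    exact hi.ne (congrFun this i)
  refine ⟨?_, hP, ?_⟩
  · rintro p ⟨⟨f, hf, rfl⟩, -⟩
    refine ⟨f, ⟨hf, rfl⟩, ?_⟩
    rintro f' ⟨hf', heq⟩
    obtain ⟨s, hs, rfl⟩ := PowerNetwork.exists_dartFlow_eq hangle hf
    obtain ⟨t, ht, rfl⟩ := PowerNetwork.exists_dartFlow_eq hangle hf'
    simp only [PowerNetwork.flowToInjection_mulVec_dartFlow] at heq
    exact PowerNetwork.dartFlow_eq_of_angleInjection_le hangle hG.2 ht hs heq.le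
  · rw [← hP]
    refine Set.Subset.antisymm (fun p hp => ⟨hsub hp, ?_⟩) ?_
    · rintro ⟨q, hq, hqp, i, hi⟩
      have := PowerNetwork.eq_of_mem_convexHull_of_le hangle hG.2 hp hq hqp
      exact hi.ne (congrFun this i)
    · rintro p ⟨hp, hmin⟩
      obtain ⟨q, hq, hqp⟩ := PowerNetwork.exists_mem_injectionRegion_le hangle hG.2 hp
      suffices q = p from this ▸ hq
      by_contra hne'
      obtain ⟨i, hi⟩ := Function.ne_iff.1 hne'
      exact hmin ⟨q, hsub hq, hqp, i, lt_of_le_of_ne (hqp i) hi⟩
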